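/- Let $\Gamma$ be a metric graph, that is, a finite connected multigraph (loops and multiple edges allowed) in which every edge $e$ is a segment of length $\ell(e)>0$, and let $g=|E|-|V|+1$ be its genus. A divisor on $\Gamma$ is a finite formal sum of points of $\Gamma$ with integer coefficients; its degree is the sum of its coefficients, it is effective if all its coefficients are non-negative, and a divisor $D$ contains a divisor $E$ if $D-E$ is effective. Two divisors are equivalent if their difference is the divisor of a continuous piecewise linear function on $\Gamma$ with integer slopes, whose coefficient at each point is the sum of the outgoing slopes there. The rank of a divisor $D$ is the largest integer $k\ge -1$ such that $D-E$ is equivalent to an effective divisor for every effective divisor $E$ of degree $k$. The graph $\Gamma$ is hyperelliptic if it has a divisor of degree $2$ and rank $1$. The Brill–Noether rank $w^r_d(\Gamma)$ is the largest integer $\rho\ge 0$ such that every effective divisor of degree $r+\rho$ is contained in a divisor of degree $d$ and rank at least $r$, and $w^r_d(\Gamma)=-1$ if there is no such $\rho$. Let $r,d$ be integers with $0<2r\le d<g$. Then $$w^r_d(\Gamma)\le d-2r.$$ Moreover, if $\Gamma$ is hyperelliptic, then $w^r_d(\Gamma)=d-2r$. -/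

import Mathlib

open Filter Topology

/-- A metric graph, presented by a model: a finite connected multigraph (loops and multiple edges
allowed) on the vertex type `V` with edge type `E`, where the edge `e` is identified with the
segment `[0, length e]`, glued at `0` to `src e` and at `length e` to `tgt e`.
The orientation of the edges is auxiliary. -/
structure MetricGraph (V E : Type*) [Fintype V] [Fintype E] where
  src : E → V
  tgt : E → V
  length : E → ℝ
  length_pos : ∀ e, 0 < length e
  connected : (SimpleGraph.fromRel fun u v => ∃ e, src e = u ∧ tgt e = v).Connected

namespace MetricGraph

variable {V E : Type*} [Fintype V] [Fintype E] (Γ : MetricGraph V E)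

/-- The genus (first Betti number) `|E| - |V| + 1`. -/
def genus (_Γ : MetricGraph V E) : ℤ := (Fintype.card E : ℤ) - (Fintype.card V : ℤ) + 1

/-- The points of the metric graph: the vertices, and the interior points of the edges. -/
abbrev Point : Type _ := V ⊕ (Σ e : E, Set.Ioo (0 : ℝ) (Γ.length e))

open Classical in
/-- The point of the edge `e` at distance `t ∈ [0, length e]` from the end `src e`. -/
noncomputable def edgePoint (e : E) (t : ℝ) : Γ.Point :=
  if h : t ∈ Set.Ioo 0 (Γ.length e) then Sum.inr ⟨e, t, h⟩
  else if t ≤ 0 then Sum.inl (Γ.src e) else Sum.inl (Γ.tgt e)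

/-- A rational function: a function that along every edge is linear with integer slope on a small
interval on either side of every point. As edges are compact segments, this says that it is
continuous and piecewise linear, with finitely many pieces and integer slopes. `slopeRight e t` and
`slopeLeft e t` are the outgoing slopes at the point `t` of the edge `e` in the directions of
increasing and of decreasing parameter; their values for `t` outside `[0, length e)`, respectively
`(0, length e]`, play no role. -/
structure RationalFunction where
  toFun : Γ.Point → ℝ
  slopeRight : E → ℝ → ℤ
  slopeLeft : E → ℝ → ℤ
  eventually_right : ∀ e, ∀ t ∈ Set.Ico 0 (Γ.length e), ∀ᶠ s in 𝓝[>] t,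
    toFun (Γ.edgePoint e s) = toFun (Γ.edgePoint e t) + slopeRight e t * (s - t)
  eventually_left : ∀ e, ∀ t ∈ Set.Ioc 0 (Γ.length e), ∀ᶠ s in 𝓝[<] t,
    toFun (Γ.edgePoint e s) = toFun (Γ.edgePoint e t) + slopeLeft e t * (t - s)

open Classical in
/-- The order of a rational function at a point: the sum of its outgoing slopes there. -/
noncomputable def RationalFunction.ord {Γ : MetricGraph V E} (f : Γ.RationalFunction) :
    Γ.Point → ℤ
  | Sum.inl v => (∑ e with Γ.src e = v, f.slopeRight e 0) +
      ∑ e with Γ.tgt e = v, f.slopeLeft e (Γ.length e)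
  | Sum.inr x => f.slopeRight x.1 x.2 + f.slopeLeft x.1 x.2

/-- Divisors: finite formal integer combinations of points. Effective means `0 ≤ D`, and
"`E` is contained in `D`" means `E ≤ D`. -/
abbrev Divisor : Type _ := Γ.Point →₀ ℤ

variable {Γ}

/-- The degree of a divisor. -/
def deg (D : Γ.Divisor) : ℤ := D.sum fun _ n => n

/-- Linear equivalence: the difference is the divisor of a rational function. -/
def LinEquiv (D D' : Γ.Divisor) : Prop :=
  ∃ f : Γ.RationalFunction, ∀ p, D' p - D p = f.ord p

/-- The integers `k ≥ -1` such that subtracting any effective divisor of degree `k` from `D` leaves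
a divisor equivalent to an effective one (this is vacuous for `k = -1`). -/
def rankSet (D : Γ.Divisor) : Set ℤ :=
  {k | -1 ≤ k ∧ ∀ F : Γ.Divisor, 0 ≤ F → deg F = k → ∃ D' : Γ.Divisor, 0 ≤ D' ∧ LinEquiv (D - F) D'}

/-- The (Baker--Norine) rank of a divisor: the largest element of `rankSet D`, which exists by
`isGreatest_rank`. -/
noncomputable def rank (D : Γ.Divisor) : ℤ := sSup (rankSet D)

variable (Γ)

/-- A metric graph is hyperelliptic if it has a divisor of degree `2` and rank `1`. -/
def IsHyperelliptic : Prop := ∃ D : Γ.Divisor, deg D = 2 ∧ rank D = 1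

/-- The integers `ρ ≥ 0` such that every effective divisor of degree `r + ρ` is contained in a
divisor of degree `d` and rank at least `r`, together with `-1`. -/
def brillNoetherSet (r d : ℤ) : Set ℤ :=
  {ρ | ρ = -1 ∨ 0 ≤ ρ ∧ ∀ F : Γ.Divisor, 0 ≤ F → deg F = r + ρ →
    ∃ D : Γ.Divisor, F ≤ D ∧ deg D = d ∧ r ≤ rank D}

/-- The Brill--Noether rank `w^r_d`: the largest `ρ ≥ 0` such that every effective divisor of degree
`r + ρ` is contained in a divisor of degree `d` and rank at least `r`, and `-1` if there is none.
For `r ≥ 0` the largest element exists by `isGreatest_brillNoetherRank`. -/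
noncomputable def brillNoetherRank (r d : ℤ) : ℤ := sSup (Γ.brillNoetherSet r d)

/-! The rest shows that the two suprema above are maxima. -/

variable {Γ}

lemma deg_add (D D' : Γ.Divisor) : deg (D + D') = deg D + deg D' :=
  Finsupp.sum_add_index' (fun _ => rfl) (fun _ _ _ => rfl)

lemma deg_sub (D D' : Γ.Divisor) : deg (D - D') = deg D - deg D' :=
  Finsupp.sum_sub_index (fun _ _ _ => rfl)

lemma deg_single (p : Γ.Point) (n : ℤ) : deg (Finsupp.single p n : Γ.Divisor) = n :=
  Finsupp.sum_single_index rfl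

lemma deg_nonneg {D : Γ.Divisor} (h : 0 ≤ D) : 0 ≤ deg D :=
  Finset.sum_nonneg fun p _ => h p

lemma slope_unique_right {φ : ℝ → ℝ} {a b c t : ℝ} (ht : a < t) {u : ℝ} (hu : t < u) {m n : ℤ}
    (h : ∀ s ∈ Set.Ioo a u, φ s = c + m * (s - b))
    (h' : ∀ᶠ s in 𝓝[>] t, φ s = φ t + n * (s - t)) : n = m := by
  obtain ⟨s, hs, hs1, hs2⟩ := (h'.and (Ioo_mem_nhdsGT hu)).exists
  rw [h s ⟨ht.trans hs1, hs2⟩, h t ⟨ht, hu⟩] at hs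
  have : ((n : ℝ) - m) * (s - t) = 0 := by linarith
  rcases mul_eq_zero.1 this with h0 | h0
  · exact_mod_cast (sub_eq_zero.1 h0)
  · linarith

lemma sum_slopes_eq_zero {φ : ℝ → ℝ} {ℓ : ℝ} (hℓ : 0 < ℓ) {sR sL : ℝ → ℤ}
    (hR : ∀ t ∈ Set.Ico 0 ℓ, ∀ᶠ s in 𝓝[>] t, φ s = φ t + sR t * (s - t))
    (hL : ∀ t ∈ Set.Ioc 0 ℓ, ∀ᶠ s in 𝓝[<] t, φ s = φ t + sL t * (t - s))
    (B : Finset ℝ) (hB : ∀ t ∈ Set.Ioo 0 ℓ, t ∉ B → sR t + sL t = 0)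
    (hB' : ∀ t ∈ B, t ∈ Set.Ioo 0 ℓ) :
    sR 0 + sL ℓ + ∑ t ∈ B, (sR t + sL t) = 0 := by
  have hright : ∀ t ∈ Set.Ico 0 ℓ, ∀ᶠ s in 𝓝[>] t, sR s = sR t := by
    intro t ht
    obtain ⟨u, hu, h⟩ := (mem_nhdsGT_iff_exists_Ioo_subset' ht.2).1 (hR t ht)
    filter_upwards [Ioo_mem_nhdsGT hu, Ioo_mem_nhdsGT ht.2] with s hs hs'
    exact slope_unique_right hs.1 hs.2 (fun x hx => h hx) (hR s ⟨ht.1.trans hs.1.le, hs'.2⟩)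
  have hleft : ∀ t ∈ Set.Ioc 0 ℓ, ∀ᶠ s in 𝓝[<] t, sR s = -sL t := by
    intro t ht
    obtain ⟨u, hu, h⟩ := (mem_nhdsLT_iff_exists_Ioo_subset' ht.1).1 (hL t ht)
    filter_upwards [Ioo_mem_nhdsLT hu, Ioo_mem_nhdsLT ht.1] with s hs hs'
    refine slope_unique_right (c := φ t) (b := t) hs.1 hs.2 (fun x hx => ?_)
      (hR s ⟨hs'.1.le, hs'.2.trans_le ht.2⟩)
    have := h hx
    simp only [Set.mem_ofPred_eq] at this
    rw [this]; push_cast; ring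
  set G : ℝ → ℤ := fun t => sR t - ∑ b ∈ B with b ≤ t, (sR b + sL b) with hG
  have hcont : ContinuousOn G (Set.Ico 0 ℓ) := by
    intro t ht
    refine (tendsto_const_nhds (x := G t)).congr' ?_
    have h1 : ∀ᶠ s in 𝓝[>] t, G s = G t := by
      have : ∀ᶠ s in 𝓝[>] t, ∀ b ∈ B, (b ≤ s ↔ b ≤ t) := by
        refine (Filter.eventually_all_finset B).2 fun b _ => ?_
        rcases le_or_gt b t with h | h
        · filter_upwards [self_mem_nhdsWithin] with s hs
          exact ⟨fun _ => h, fun _ => h.trans (le_of_lt hs)⟩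
        · filter_upwards [Ioo_mem_nhdsGT h] with s hs
          exact ⟨fun h' => absurd h' (not_le.2 hs.2), fun h' => absurd h' (not_le.2 h)⟩
      filter_upwards [this, hright t ht] with s hs hs'
      simp only [hG, hs']
      rw [Finset.filter_congr hs]
    have h2 : ∀ᶠ s in 𝓝[<] t, 0 ≤ s → G s = G t := by
      rcases ht.1.eq_or_lt with h0 | h0
      · filter_upwards [self_mem_nhdsWithin] with s hs h
        exact absurd h (not_le.2 (by rw [h0]; exact hs))
      have : ∀ᶠ s in 𝓝[<] t, ∀ b ∈ B, (b ≤ t ↔ b ≤ s ∨ b = t) := by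
        refine (Filter.eventually_all_finset B).2 fun b _ => ?_
        rcases lt_trichotomy b t with h | h | h
        · filter_upwards [Ioo_mem_nhdsLT h] with s hs
          exact ⟨fun _ => Or.inl hs.1.le, fun _ => h.le⟩
        · exact Eventually.of_forall fun s => ⟨fun _ => Or.inr h, fun _ => h.le⟩
        · filter_upwards [self_mem_nhdsWithin] with s hs
          have hs : s < t := hs
          constructor
          · intro h'; linarith
          · rintro (h' | h') <;> linarith
      filter_upwards [this, hleft t ⟨h0, ht.2.le⟩, self_mem_nhdsWithin] with s hs hs' hst _
      have hst : s < t := hst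
      simp only [hG, hs']
      rw [Finset.filter_congr hs, Finset.filter_or, Finset.sum_union]
      · rw [Finset.filter_eq']
        split_ifs with hb
        · rw [Finset.sum_singleton]; ring
        · rw [Finset.sum_empty]
          have := hB t ⟨h0, ht.2⟩ hb
          linarith
      · rw [Finset.disjoint_filter]
        intro b _ hb hb'
        linarith
    have h1' := eventually_nhdsWithin_iff.1 h1
    have h2' := eventually_nhdsWithin_iff.1 h2
    refine eventually_nhdsWithin_iff.2 ?_
    filter_upwards [h1', h2'] with s hs1 hs2 hs
    rcases lt_trichotomy s t with h | h | h
    · exact (hs2 h hs.1).symm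
    · rw [h]
    · exact (hs1 h).symm
  have hℓ' : ∀ᶠ s in 𝓝[<] ℓ, ∀ b ∈ B, b ≤ s := by
    refine (Filter.eventually_all_finset B).2 fun b hb => ?_
    filter_upwards [Ioo_mem_nhdsLT (hB' b hb).2] with s hs using hs.1.le
  obtain ⟨s, ⟨hs1, hs2⟩, hs3⟩ :=
    ((hℓ'.and (hleft ℓ ⟨hℓ, le_rfl⟩)).and (Ioo_mem_nhdsLT hℓ)).exists
  have key := (isPreconnected_Ico (a := (0 : ℝ)) (b := ℓ)).constant hcont
    (x := 0) (y := s) ⟨le_rfl, hℓ⟩ ⟨hs3.1.le, hs3.2⟩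
  simp only [hG] at key
  rw [Finset.filter_true_of_mem hs1, Finset.filter_false_of_mem, Finset.sum_empty, hs2] at key
  · linarith
  · intro b hb; exact not_le.2 (hB' b hb).1

lemma deg_eq_zero_of_ord {D : Γ.Divisor} (f : Γ.RationalFunction) (h : ∀ p, D p = f.ord p) :
    deg D = 0 := by
  classical
  have hsplit : deg D = ∑ v, D (Sum.inl v) + ∑ x ∈ D.support.toRight, D (Sum.inr x) := by
    have : D.support ⊆ (Finset.univ : Finset V).disjSum D.support.toRight := by
      intro p hp
      rcases p with v | x
      · simp
      · simpa using hp
    unfold deg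
    rw [Finsupp.sum_of_support_subset D this _ (fun _ _ => rfl), Finset.sum_disjSum]
  have hedge : ∀ e, f.slopeRight e 0 + f.slopeLeft e (Γ.length e) +
      ∑ x ∈ D.support.toRight with x.1 = e, D (Sum.inr x) = 0 := by
    intro e
    set R := D.support.toRight.filter fun x => x.1 = e with hR
    have hinj : Set.InjOn (fun x : (Σ e : E, Set.Ioo (0 : ℝ) (Γ.length e)) => (x.2 : ℝ)) R := by
      rintro ⟨e₁, t₁⟩ h₁ ⟨e₂, t₂⟩ h₂ h12
      simp only [hR, Finset.coe_filter, Set.mem_ofPred_eq] at h₁ h₂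
      obtain ⟨_, rfl⟩ := h₁
      obtain ⟨_, rfl⟩ := h₂
      have : t₁ = t₂ := Subtype.ext h12
      rw [this]
    have := sum_slopes_eq_zero (Γ.length_pos e) (f.eventually_right e) (f.eventually_left e)
      (R.image fun x => (x.2 : ℝ)) ?_ ?_
    · rw [Finset.sum_image hinj] at this
      rw [← this]
      congr 1
      refine Finset.sum_congr rfl ?_
      rintro ⟨e', t⟩ hx
      obtain rfl : e' = e := (Finset.mem_filter.1 hx).2
      exact h _
    · intro t ht htB
      by_contra hne
      refine htB (Finset.mem_image.2 ⟨⟨e, t, ht⟩, ?_, rfl⟩)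
      rw [hR, Finset.mem_filter, Finset.mem_toRight, Finsupp.mem_support_iff, h]
      exact ⟨hne, rfl⟩
    · intro t ht
      obtain ⟨⟨e', t'⟩, hx, rfl⟩ := Finset.mem_image.1 ht
      obtain rfl : e' = e := (Finset.mem_filter.1 hx).2
      exact t'.2
  have hv : ∑ v, D (Sum.inl v) = ∑ e, (f.slopeRight e 0 + f.slopeLeft e (Γ.length e)) := by
    rw [Finset.sum_add_distrib, ← Finset.sum_fiberwise Finset.univ Γ.src,
      ← Finset.sum_fiberwise Finset.univ Γ.tgt (fun e => f.slopeLeft e (Γ.length e)),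
      ← Finset.sum_add_distrib]
    exact Finset.sum_congr rfl fun v _ => h _
  rw [hsplit, hv, ← Finset.sum_fiberwise D.support.toRight Sigma.fst, ← Finset.sum_add_distrib]
  exact Finset.sum_eq_zero fun e _ => hedge e

lemma LinEquiv.deg_eq {D D' : Γ.Divisor} (h : LinEquiv D D') : deg D = deg D' := by
  obtain ⟨f, hf⟩ := h
  have := deg_eq_zero_of_ord (D := D' - D) f hf
  rw [deg_sub] at this
  linarith

lemma exists_effective_deg (Γ : MetricGraph V E) {k : ℤ} (hk : 0 ≤ k) :
    ∃ F : Γ.Divisor, 0 ≤ F ∧ deg F = k := by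
  obtain ⟨v⟩ := Γ.connected.nonempty
  exact ⟨Finsupp.single (Sum.inl v) k, Finsupp.single_nonneg.2 hk, deg_single _ _⟩

theorem isGreatest_rank (D : Γ.Divisor) : IsGreatest (rankSet D) (rank D) := by
  have hb : BddAbove (rankSet D) := by
    refine ⟨max (-1) (deg D), fun k hk => ?_⟩
    rcases lt_or_ge k 0 with h | h
    · exact le_max_of_le_left (by omega)
    · obtain ⟨F, hF, hFk⟩ := exists_effective_deg Γ h
      obtain ⟨D', hD', hl⟩ := hk.2 F hF hFk
      have h1 := hl.deg_eq
      have h2 := deg_nonneg hD'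
      rw [deg_sub] at h1
      exact le_max_of_le_right (by omega)
  have hne : (rankSet D).Nonempty :=
    ⟨-1, le_rfl, fun F hF hk => absurd (deg_nonneg hF) (by omega)⟩
  exact ⟨Int.csSup_mem hne hb, fun k hk => le_csSup hb hk⟩

theorem isGreatest_brillNoetherRank (Γ : MetricGraph V E) {r d : ℤ} (hr : 0 ≤ r) :
    IsGreatest (Γ.brillNoetherSet r d) (Γ.brillNoetherRank r d) := by
  have hb : BddAbove (Γ.brillNoetherSet r d) := by
    refine ⟨max (-1) d, fun k hk => ?_⟩
    rcases hk with h | ⟨h, hk⟩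
    · exact le_max_of_le_left h.le
    · obtain ⟨F, hF, hFk⟩ := exists_effective_deg Γ (add_nonneg hr h)
      obtain ⟨D, hFD, hD, -⟩ := hk F hF hFk
      have h1 := deg_nonneg (sub_nonneg.2 hFD)
      rw [deg_sub] at h1
      exact le_max_of_le_right (by omega)
  exact ⟨Int.csSup_mem ⟨-1, Or.inl rfl⟩ hb, fun k hk => le_csSup hb hk⟩

end MetricGraph

open Filter Topology

namespace MetricGraph

variable {V E : Type*} [Fintype V] [Fintype E] {Γ : MetricGraph V E}

/-! ### Linear equivalence -/

namespace RationalFunction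

/-! Upper bound: delete edges outside a spanning tree and let `F` be the sum of the midpoints of `r
+ ρ ≤ g` of them. Then `F - v` is not equivalent to an effective divisor for any vertex `v`
(`not_linEquiv_midpointDivisor_sub`). The reason is a maximum principle: a rational function
realising such an equivalence would have a maximum locus that reaches a vertex, spreads over the
remaining connected graph to `v`, and contradicts positive order there. If `F ≤ D` with `deg D = d`,
rank at least `r` and `ρ > d - 2r`, then `deg (D - F) = d - r - ρ < r`, so one may subtract from `D`
both `D - F` and a copy of `v`; this makes `F - v` equivalent to an effective divisor, which is
impossible.

Equality in the hyperelliptic case: let `D₀` have degree 2 and rank 1. Given `F` of degree `d - r`,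
take `G ≤ F` of degree `r` and an effective `Q` equivalent to `r • D₀ - G`. Then `F + Q` contains
`F`, has degree `d`, and is equivalent to `r • D₀` plus an effective divisor, hence has rank at
least `r` (`IsHyperelliptic.exists_le_rank`). -/

/-- The sum of two rational functions. -/
def add (f g : Γ.RationalFunction) : Γ.RationalFunction where
  toFun p := f.toFun p + g.toFun p
  slopeRight e t := f.slopeRight e t + g.slopeRight e t
  slopeLeft e t := f.slopeLeft e t + g.slopeLeft e t
  eventually_right e t ht := by
    filter_upwards [f.eventually_right e t ht, g.eventually_right e t ht] with s hf hg
    rw [hf, hg]; push_cast; ring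
  eventually_left e t ht := by
    filter_upwards [f.eventually_left e t ht, g.eventually_left e t ht] with s hf hg
    rw [hf, hg]; push_cast; ring

/-- The negative of a rational function. -/
def neg (f : Γ.RationalFunction) : Γ.RationalFunction where
  toFun p := -f.toFun p
  slopeRight e t := -f.slopeRight e t
  slopeLeft e t := -f.slopeLeft e t
  eventually_right e t ht := by
    filter_upwards [f.eventually_right e t ht] with s hf
    rw [hf]; push_cast; ring
  eventually_left e t ht := by
    filter_upwards [f.eventually_left e t ht] with s hf
    rw [hf]; push_cast; ring

/-- The zero rational function. -/
def zero (Γ : MetricGraph V E) : Γ.RationalFunction where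
  toFun _ := 0
  slopeRight _ _ := 0
  slopeLeft _ _ := 0
  eventually_right e t ht := by simp
  eventually_left e t ht := by simp

lemma ord_add (f g : Γ.RationalFunction) (p : Γ.Point) :
    (f.add g).ord p = f.ord p + g.ord p := by
  rcases p with v | x
  · simp only [ord, add, Finset.sum_add_distrib]; ring
  · simp only [ord, add]; ring

lemma ord_neg (f : Γ.RationalFunction) (p : Γ.Point) : f.neg.ord p = -f.ord p := by
  rcases p with v | x
  · simp only [ord, neg, Finset.sum_neg_distrib]; ring
  · simp only [ord, neg]; ring

lemma ord_zero (p : Γ.Point) : (zero Γ).ord p = 0 := by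
  rcases p with v | x <;> simp [ord, zero]

end RationalFunction

lemma LinEquiv.refl (D : Γ.Divisor) : LinEquiv D D :=
  ⟨.zero Γ, fun p => by rw [RationalFunction.ord_zero, sub_self]⟩

lemma LinEquiv.symm {D D' : Γ.Divisor} (h : LinEquiv D D') : LinEquiv D' D := by
  obtain ⟨f, hf⟩ := h
  exact ⟨f.neg, fun p => by rw [f.ord_neg, ← hf]; ring⟩

lemma LinEquiv.add {D₁ D₂ D₁' D₂' : Γ.Divisor} (h₁ : LinEquiv D₁ D₁') (h₂ : LinEquiv D₂ D₂') :
    LinEquiv (D₁ + D₂) (D₁' + D₂') := by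
  obtain ⟨f, hf⟩ := h₁
  obtain ⟨g, hg⟩ := h₂
  refine ⟨f.add g, fun p => ?_⟩
  rw [f.ord_add, ← hf, ← hg, Finsupp.add_apply, Finsupp.add_apply]
  ring

/-! ### Effective divisors and the rank -/

/-- A nonzero effective divisor contains a point. -/
lemma exists_single_le {F : Γ.Divisor} (hF : 0 ≤ F) (hdeg : 0 < deg F) :
    ∃ p, Finsupp.single p 1 ≤ F := by
  classical
  obtain ⟨p, -, hp⟩ := Finset.exists_lt_of_sum_lt
    (show ∑ p ∈ F.support, (0 : ℤ) < ∑ p ∈ F.support, F p by simpa [deg, Finsupp.sum] using hdeg)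
  refine ⟨p, fun q => ?_⟩
  rw [Finsupp.single_apply]
  split_ifs with h
  · rw [← h]; omega
  · exact hF q

/-- An effective divisor contains effective divisors of all smaller degrees. -/
lemma exists_le_deg_eq (n : ℕ) {F : Γ.Divisor} (hF : 0 ≤ F) (hn : (n : ℤ) ≤ deg F) :
    ∃ G : Γ.Divisor, 0 ≤ G ∧ G ≤ F ∧ deg G = n := by
  induction n with
  | zero => exact ⟨0, le_rfl, hF, by simp [deg]⟩
  | succ n ih =>
    push_cast at hn ⊢
    obtain ⟨G, hG, hGF, hGn⟩ := ih (by omega)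
    obtain ⟨p, hp⟩ := exists_single_le (F := F - G) (sub_nonneg.2 hGF) (by rw [deg_sub]; omega)
    refine ⟨G + Finsupp.single p 1, add_nonneg hG (Finsupp.single_nonneg.2 zero_le_one), ?_, ?_⟩
    · rw [add_comm]; exact le_sub_iff_add_le.1 hp
    · rw [deg_add, deg_single, hGn]

/-- If a divisor has rank at least one, then its `n`-th multiple has rank at least `n`. -/
lemma exists_linEquiv_nsmul_sub {D : Γ.Divisor} (hD : 1 ∈ rankSet D) (n : ℕ) {F : Γ.Divisor}
    (hF : 0 ≤ F) (hn : deg F = n) : ∃ D' : Γ.Divisor, 0 ≤ D' ∧ LinEquiv (n • D - F) D' := by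
  induction n generalizing F with
  | zero =>
    obtain rfl : F = 0 := by
      by_contra hne
      obtain ⟨p, hp⟩ := Finsupp.ne_iff.1 hne
      have h1 : Finsupp.single p 1 ≤ F := fun q => by
        classical
        rw [Finsupp.single_apply]
        split_ifs with h
        · have := hF p
          rw [← h]
          simp only [Finsupp.coe_zero, Pi.zero_apply] at hp this
          omega
        · exact hF q
      have := deg_nonneg (sub_nonneg.2 h1)
      rw [deg_sub, deg_single, hn] at this
      simp at this
    exact ⟨0, le_rfl, by simpa using LinEquiv.refl _⟩
  | succ n ih =>
    push_cast at hn
    obtain ⟨p, hp⟩ := exists_single_le hF (by omega)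
    -- One copy of `D` absorbs the point `p`, the other `n` copies absorb the rest of `F`.
    obtain ⟨D₁, hD₁, h₁⟩ := ih (F := F - Finsupp.single p 1) (sub_nonneg.2 hp)
      (by rw [deg_sub, deg_single, hn]; ring)
    obtain ⟨D₂, hD₂, h₂⟩ := hD.2 (Finsupp.single p 1) (Finsupp.single_nonneg.2 zero_le_one)
      (deg_single _ _)
    refine ⟨D₁ + D₂, add_nonneg hD₁ hD₂, ?_⟩
    have := h₁.add h₂
    rwa [show n • D - (F - Finsupp.single p 1) + (D - Finsupp.single p 1) = (n + 1) • D - F by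
      rw [succ_nsmul]; abel] at this

/-- On a hyperelliptic graph every effective divisor of degree `m ≥ n` is contained in a divisor of
degree `m + n` and rank at least `n`. -/
lemma IsHyperelliptic.exists_le_rank (hΓ : Γ.IsHyperelliptic) (n : ℕ) {F : Γ.Divisor}
    (hF : 0 ≤ F) (hn : (n : ℤ) ≤ deg F) :
    ∃ D : Γ.Divisor, F ≤ D ∧ deg D = deg F + n ∧ n ≤ rank D := by
  obtain ⟨D₀, hdeg, hrank⟩ := hΓ
  have h1 : 1 ∈ rankSet D₀ := hrank ▸ (isGreatest_rank D₀).1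
  have hdegn : deg (n • D₀) = 2 * n := by
    induction n with
    | zero => simp [deg]
    | succ n ih => rw [succ_nsmul, deg_add, ih (by push_cast at hn; omega), hdeg]; push_cast; ring
  obtain ⟨G, hG, hGF, hGn⟩ := exists_le_deg_eq n hF hn
  obtain ⟨Q, hQ, hGQ⟩ := exists_linEquiv_nsmul_sub h1 n hG hGn
  refine ⟨F + Q, le_add_of_nonneg_right hQ, ?_, (isGreatest_rank _).2 ⟨by omega, ?_⟩⟩
  · have := hGQ.deg_eq
    rw [deg_sub, hdegn] at this
    rw [deg_add]; omega
  · intro F' hF' hF'n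
    obtain ⟨Q', hQ', hFQ'⟩ := exists_linEquiv_nsmul_sub h1 n hF' hF'n
    refine ⟨F - G + Q', add_nonneg (sub_nonneg.2 hGF) hQ', ?_⟩
    -- Since `F + Q` is equivalent to `(F - G) + n • D₀`, subtracting `F'` only affects the summand
    -- `n • D₀`.
    have := (hGQ.symm.add hFQ').add (LinEquiv.refl (F - n • D₀))
    rwa [show Q + (n • D₀ - F') + (F - n • D₀) = F + Q - F' by abel,
      show n • D₀ - G + Q' + (F - n • D₀) = F - G + Q' by abel] at this

/-! ### Effective divisors of rank zero -/

/-- There are at least `g` edges whose removal leaves the graph connected. -/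
lemma exists_removable_edges (Γ : MetricGraph V E) (k : ℕ) (hk : (k : ℤ) ≤ Γ.genus) :
    ∃ C : Finset E, C.card = k ∧ ∀ P : V → Prop, (∀ e ∉ C, P (Γ.src e) ↔ P (Γ.tgt e)) →
      ∀ u v, P u → P v := by
  classical
  obtain ⟨T, hT, htree⟩ := Γ.connected.exists_isTree_le
  -- The tree lives in the simple graph underlying the multigraph, so each tree edge is lifted to
  -- one edge of `E`. At most `|V| - 1` edges are lifts, which leaves at least `g` to remove.
  have hlift : ∀ x : T.edgeSet, ∃ e : E, s(Γ.src e, Γ.tgt e) = x := by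
    rintro ⟨x, hx⟩
    induction x using Sym2.ind with
    | _ u v =>
      have hadj := hT (T.mem_edgeSet.1 hx)
      rw [SimpleGraph.fromRel_adj] at hadj
      rcases hadj.2 with ⟨e, rfl, rfl⟩ | ⟨e, rfl, rfl⟩
      · exact ⟨e, rfl⟩
      · exact ⟨e, Sym2.eq_swap⟩
  choose φ hφ using hlift
  have hcard : Fintype.card T.edgeSet + 1 = Fintype.card V := by
    rw [← htree.card_edgeFinset, SimpleGraph.edgeFinset_card]
  have hS : (Finset.univ.image φ).card ≤ Fintype.card T.edgeSet := Finset.card_image_le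
  obtain ⟨C, hC, hCk⟩ := Finset.exists_subset_card_eq
    (s := (Finset.univ.image φ)ᶜ) (n := k) (by
      rw [Finset.card_compl]
      unfold genus at hk
      omega)
  refine ⟨C, hCk, fun P hP u v hu => ?_⟩
  have hstep : ∀ a b, T.Adj a b → P a → P b := by
    intro a b hab ha
    have he := hφ ⟨s(a, b), hab⟩
    have hP' := hP (φ ⟨s(a, b), hab⟩) fun h => by
      have := hC h
      simp at this
    rcases Sym2.eq_iff.1 he with ⟨h1, h2⟩ | ⟨h1, h2⟩
    · rw [h1, h2] at hP'; exact hP'.1 ha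
    · rw [h1, h2] at hP'; exact hP'.2 ha
  obtain ⟨w⟩ := htree.connected u v
  induction w with
  | nil => exact hu
  | cons hab _ ih => exact ih (hstep _ _ hab hu)

/-! ### The maximum locus of a rational function. -/

lemma edgePoint_zero (Γ : MetricGraph V E) (e : E) : Γ.edgePoint e 0 = Sum.inl (Γ.src e) := by
  simp [edgePoint]

lemma edgePoint_length (Γ : MetricGraph V E) (e : E) :
    Γ.edgePoint e (Γ.length e) = Sum.inl (Γ.tgt e) := by
  simp [edgePoint, Γ.length_pos e]

lemma edgePoint_of_mem (Γ : MetricGraph V E) (e : E) {t : ℝ} (ht : t ∈ Set.Ioo 0 (Γ.length e)) :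
    Γ.edgePoint e t = Sum.inr ⟨e, t, ht⟩ :=
  dif_pos ht

namespace RationalFunction

variable (f : Γ.RationalFunction)

lemma continuousOn_edge (e : E) :
    ContinuousOn (fun t => f.toFun (Γ.edgePoint e t)) (Set.Icc 0 (Γ.length e)) := by
  intro t ht
  have hR : ContinuousWithinAt (fun t => f.toFun (Γ.edgePoint e t))
      (Set.Icc 0 (Γ.length e) ∩ Set.Ioi t) t := by
    rcases ht.2.lt_or_eq with h | h
    · have hc : Tendsto (fun s => f.toFun (Γ.edgePoint e t) + f.slopeRight e t * (s - t))
          (𝓝[>] t) (𝓝 (f.toFun (Γ.edgePoint e t))) := by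
        have : Continuous fun s => f.toFun (Γ.edgePoint e t) + f.slopeRight e t * (s - t) := by
          fun_prop
        simpa using (this.tendsto t).mono_left nhdsWithin_le_nhds
      exact (hc.congr' ((f.eventually_right e t ⟨ht.1, h⟩).mono fun s hs => hs.symm)).mono_left
        (nhdsWithin_mono _ Set.inter_subset_right)
    · rw [show Set.Icc 0 (Γ.length e) ∩ Set.Ioi t = ∅ by
        ext s; simp only [Set.mem_inter_iff, Set.mem_Icc, Set.mem_Ioi, Set.mem_empty_iff_false]
        grind]
      simp [ContinuousWithinAt]
  have hL : ContinuousWithinAt (fun t => f.toFun (Γ.edgePoint e t))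
      (Set.Icc 0 (Γ.length e) ∩ Set.Iio t) t := by
    rcases ht.1.lt_or_eq with h | h
    · have hc : Tendsto (fun s => f.toFun (Γ.edgePoint e t) + f.slopeLeft e t * (t - s))
          (𝓝[<] t) (𝓝 (f.toFun (Γ.edgePoint e t))) := by
        have : Continuous fun s => f.toFun (Γ.edgePoint e t) + f.slopeLeft e t * (t - s) := by
          fun_prop
        simpa using (this.tendsto t).mono_left nhdsWithin_le_nhds
      exact (hc.congr' ((f.eventually_left e t ⟨h, ht.2⟩).mono fun s hs => hs.symm)).mono_left
        (nhdsWithin_mono _ Set.inter_subset_right)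
    · rw [show Set.Icc 0 (Γ.length e) ∩ Set.Iio t = ∅ by
        ext s; simp only [Set.mem_inter_iff, Set.mem_Icc, Set.mem_Iio, Set.mem_empty_iff_false]
        grind]
      simp [ContinuousWithinAt]
  have := (hR.union hL).insert
  refine this.mono fun s hs => ?_
  rcases lt_trichotomy s t with h | h | h
  · exact Or.inr (Or.inr ⟨hs, h⟩)
  · exact Or.inl h
  · exact Or.inr (Or.inl ⟨hs, h⟩)

/-- A rational function attains its maximum. -/
lemma exists_forall_le : ∃ p, ∀ q, f.toFun q ≤ f.toFun p := by
  have hedge : ∀ e, ∃ t, ∀ s ∈ Set.Icc 0 (Γ.length e),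
      f.toFun (Γ.edgePoint e s) ≤ f.toFun (Γ.edgePoint e t) := fun e => by
    obtain ⟨t, -, ht⟩ := isCompact_Icc.exists_isMaxOn
      (Set.nonempty_Icc.2 (Γ.length_pos e).le) (f.continuousOn_edge e)
    exact ⟨t, fun s hs => ht hs⟩
  choose τ hτ using hedge
  have : Nonempty V := Γ.connected.nonempty
  obtain ⟨i, hi⟩ := Finite.exists_max
    (fun i : V ⊕ E => f.toFun (Sum.elim Sum.inl (fun e => Γ.edgePoint e (τ e)) i))
  refine ⟨Sum.elim Sum.inl (fun e => Γ.edgePoint e (τ e)) i, fun q => ?_⟩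
  rcases q with v | ⟨e, t, ht⟩
  · exact hi (Sum.inl v)
  · rw [← Γ.edgePoint_of_mem e ht]
    exact (hτ e t ⟨ht.1.le, ht.2.le⟩).trans (hi (Sum.inr e))

variable {f} {M : ℝ}

lemma slopeRight_nonpos (hM : ∀ q, f.toFun q ≤ M) {e : E} {t : ℝ}
    (ht : t ∈ Set.Ico 0 (Γ.length e)) (h : f.toFun (Γ.edgePoint e t) = M) :
    f.slopeRight e t ≤ 0 := by
  obtain ⟨s, hs, hst⟩ := ((f.eventually_right e t ht).and self_mem_nhdsWithin).exists
  have h1 := hM (Γ.edgePoint e s)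
  have hst : t < s := hst
  by_contra! hpos
  have : (0 : ℝ) < f.slopeRight e t * (s - t) :=
    mul_pos (by exact_mod_cast hpos) (sub_pos.2 hst)
  linarith

lemma slopeLeft_nonpos (hM : ∀ q, f.toFun q ≤ M) {e : E} {t : ℝ}
    (ht : t ∈ Set.Ioc 0 (Γ.length e)) (h : f.toFun (Γ.edgePoint e t) = M) :
    f.slopeLeft e t ≤ 0 := by
  obtain ⟨s, hs, hst⟩ := ((f.eventually_left e t ht).and self_mem_nhdsWithin).exists
  have h1 := hM (Γ.edgePoint e s)
  have hst : s < t := hst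
  by_contra! hpos
  have : (0 : ℝ) < f.slopeLeft e t * (t - s) :=
    mul_pos (by exact_mod_cast hpos) (sub_pos.2 hst)
  linarith

/-- Continuous induction along the edge: the level set is closed, and slope zero at one of its
points extends it a little to the right. -/
lemma eq_at_tgt {e : E} {t : ℝ} (ht : t ∈ Set.Icc 0 (Γ.length e))
    (h : f.toFun (Γ.edgePoint e t) = M)
    (hs : ∀ s ∈ Set.Ico t (Γ.length e), f.toFun (Γ.edgePoint e s) = M → f.slopeRight e s = 0) :
    f.toFun (Sum.inl (Γ.tgt e)) = M := by
  rw [← edgePoint_length]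
  refine IsClosed.mem_of_ge_of_forall_exists_gt (a := t)
    (s := {s | f.toFun (Γ.edgePoint e s) = M}) ?_ h ht.2 ?_
  · rw [Set.inter_comm]
    exact ((f.continuousOn_edge e).mono (Set.Icc_subset_Icc_left ht.1)).preimage_isClosed_of_isClosed
      isClosed_Icc (isClosed_singleton (x := M))
  · rintro x ⟨hx, hx'⟩
    obtain ⟨s, h1, h2⟩ := ((f.eventually_right e x ⟨ht.1.trans hx'.1, hx'.2⟩).and
      (Ioc_mem_nhdsGT hx'.2)).exists
    refine ⟨s, ?_, h2⟩
    have hx : f.toFun (Γ.edgePoint e x) = M := hx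
    simpa [hs x hx' hx, hx] using h1

lemma eq_at_src {e : E} {t : ℝ} (ht : t ∈ Set.Icc 0 (Γ.length e))
    (h : f.toFun (Γ.edgePoint e t) = M)
    (hs : ∀ s ∈ Set.Ioc 0 t, f.toFun (Γ.edgePoint e s) = M → f.slopeLeft e s = 0) :
    f.toFun (Sum.inl (Γ.src e)) = M := by
  rw [← edgePoint_zero, ← neg_zero]
  -- The induction principle moves to the right, so the parameter is reflected by `s ↦ -s`.
  refine IsClosed.mem_of_ge_of_forall_exists_gt (a := -t) (b := (0 : ℝ))
    (s := {s | f.toFun (Γ.edgePoint e (-s)) = M}) ?_ (by simpa using h) (by linarith [ht.1]) ?_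
  · rw [Set.inter_comm]
    refine ContinuousOn.preimage_isClosed_of_isClosed
      (f := fun s => f.toFun (Γ.edgePoint e (-s))) ?_ isClosed_Icc (isClosed_singleton (x := M))
    refine (f.continuousOn_edge e).comp continuous_neg.continuousOn fun s hs => ?_
    exact ⟨by linarith [hs.2], by linarith [hs.1, ht.2]⟩
  · rintro x ⟨hx, hx'⟩
    have hx : f.toFun (Γ.edgePoint e (-x)) = M := hx
    have hx0 : 0 < -x := by linarith [hx'.2]
    have hxt : -x ≤ t := by linarith [hx'.1]
    obtain ⟨s, h1, h2⟩ := ((f.eventually_left e (-x) ⟨hx0, hxt.trans ht.2⟩).and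
      (Ico_mem_nhdsLT hx0)).exists
    refine ⟨-s, ?_, by linarith [h2.2], by linarith [h2.1]⟩
    simpa [hs (-x) ⟨hx0, hxt⟩ hx, hx] using h1

/-- If the order at a vertex is nonnegative and the maximum is attained there, all outgoing slopes
vanish. -/
lemma slopes_eq_zero_of_vertex (hM : ∀ q, f.toFun q ≤ M) {v : V} (hv : f.toFun (Sum.inl v) = M)
    (hord : 0 ≤ f.ord (Sum.inl v)) :
    f.ord (Sum.inl v) = 0 ∧ (∀ e, Γ.src e = v → f.slopeRight e 0 = 0) ∧
      ∀ e, Γ.tgt e = v → f.slopeLeft e (Γ.length e) = 0 := by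
  classical
  have hR : ∀ e ∈ Finset.univ.filter (fun e => Γ.src e = v), f.slopeRight e 0 ≤ 0 := fun e he =>
    slopeRight_nonpos hM ⟨le_rfl, Γ.length_pos e⟩
      (by rw [edgePoint_zero, (Finset.mem_filter.1 he).2, hv])
  have hL : ∀ e ∈ Finset.univ.filter (fun e => Γ.tgt e = v), f.slopeLeft e (Γ.length e) ≤ 0 :=
    fun e he => slopeLeft_nonpos hM ⟨Γ.length_pos e, le_rfl⟩
      (by rw [edgePoint_length, (Finset.mem_filter.1 he).2, hv])
  have hRs := Finset.sum_nonpos hR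
  have hLs := Finset.sum_nonpos hL
  have hord' : f.ord (Sum.inl v) = (∑ e with Γ.src e = v, f.slopeRight e 0) +
      ∑ e with Γ.tgt e = v, f.slopeLeft e (Γ.length e) := by
    simp only [ord]
  rw [hord'] at hord ⊢
  refine ⟨by omega, fun e he => ?_, fun e he => ?_⟩
  · exact (Finset.sum_eq_zero_iff_of_nonpos hR).1 (by omega) e (by simpa using he)
  · exact (Finset.sum_eq_zero_iff_of_nonpos hL).1 (by omega) e (by simpa using he)

end RationalFunction

/-! ### Midpoint divisors. -/

/-- The divisor that is the sum of the midpoints of a set of edges. -/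
noncomputable def midpointDivisor (Γ : MetricGraph V E) (C : Finset E) : Γ.Divisor :=
  ∑ e ∈ C, Finsupp.single
    (Sum.inr ⟨e, Γ.length e / 2, half_pos (Γ.length_pos e), half_lt_self (Γ.length_pos e)⟩) 1

lemma midpointDivisor_nonneg (C : Finset E) : 0 ≤ Γ.midpointDivisor C :=
  Finset.sum_nonneg fun _ _ => Finsupp.single_nonneg.2 zero_le_one

lemma deg_midpointDivisor (C : Finset E) : deg (Γ.midpointDivisor C) = C.card := by
  classical
  unfold midpointDivisor
  induction C using Finset.induction_on with
  | empty => simp [deg]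
  | insert e C he ih =>
    rw [Finset.sum_insert he, deg_add, deg_single, ih, Finset.card_insert_of_notMem he]
    push_cast; ring

lemma midpointDivisor_inl (C : Finset E) (v : V) : Γ.midpointDivisor C (Sum.inl v) = 0 := by
  simp [midpointDivisor, Finsupp.finsetSum_apply]

open Classical in
lemma midpointDivisor_inr (C : Finset E) (e : E) (t : Set.Ioo 0 (Γ.length e)) :
    Γ.midpointDivisor C (Sum.inr ⟨e, t⟩) = if e ∈ C ∧ (t : ℝ) = Γ.length e / 2 then 1 else 0 := by
  rw [midpointDivisor, Finsupp.finsetSum_apply]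
  by_cases he : e ∈ C
  · rw [Finset.sum_eq_single_of_mem e he]
    · simp only [Finsupp.single_apply, Sum.inr.injEq, Sigma.mk.injEq, heq_eq_eq, true_and, he,
        Subtype.ext_iff, eq_comm]
    · intro e' _ hne
      rw [Finsupp.single_apply, if_neg]
      intro h
      simp only [Sum.inr.injEq, Sigma.mk.injEq] at h
      exact hne h.1
  · rw [if_neg fun h => he h.1]
    refine Finset.sum_eq_zero fun e' he' => ?_
    rw [Finsupp.single_apply, if_neg]
    intro h
    simp only [Sum.inr.injEq, Sigma.mk.injEq] at h
    exact he (h.1 ▸ he')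

/-- If removing the edges in `C` leaves the graph connected, then the sum of their midpoints is not
equivalent to an effective divisor containing a given vertex. -/
lemma not_linEquiv_midpointDivisor_sub {C : Finset E}
    (hC : ∀ P : V → Prop, (∀ e ∉ C, P (Γ.src e) ↔ P (Γ.tgt e)) → ∀ u v, P u → P v)
    (v₀ : V) {D : Γ.Divisor} (hD : 0 ≤ D) :
    ¬ LinEquiv (Γ.midpointDivisor C - Finsupp.single (Sum.inl v₀) 1) D := by
  classical
  rintro ⟨f, hf⟩
  obtain ⟨p, hp⟩ := f.exists_forall_le
  set M := f.toFun p with hMdef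
  -- Here `f.ord` is `D` minus the midpoints plus `v₀`: negative order can occur only at the chosen
  -- midpoints, and is then at least `-1`.
  have hvert : ∀ v, 0 ≤ f.ord (Sum.inl v) := fun v => by
    have h1 : 0 ≤ D (Sum.inl v) := hD _
    rw [← hf, Finsupp.sub_apply, midpointDivisor_inl, Finsupp.single_apply]
    split_ifs <;> omega
  have hint : ∀ e (t : Set.Ioo 0 (Γ.length e)), f.toFun (Sum.inr ⟨e, t⟩) = M →
      f.slopeRight e t ≤ 0 ∧ f.slopeLeft e t ≤ 0 ∧ -1 ≤ f.slopeRight e t + f.slopeLeft e t ∧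
      (¬ (e ∈ C ∧ (t : ℝ) = Γ.length e / 2) → f.slopeRight e t = 0 ∧ f.slopeLeft e t = 0) := by
    intro e t ht
    have h1 : 0 ≤ D (Sum.inr ⟨e, t⟩) := hD _
    have h2 := hf (Sum.inr ⟨e, t⟩)
    have h3 : f.ord (Sum.inr ⟨e, t⟩) = f.slopeRight e t + f.slopeLeft e t := rfl
    rw [Finsupp.sub_apply, midpointDivisor_inr, Finsupp.single_eq_of_ne (by simp), h3] at h2
    rw [← Γ.edgePoint_of_mem e t.2] at ht
    have hR := RationalFunction.slopeRight_nonpos hp ⟨t.2.1.le, t.2.2⟩ ht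
    have hL := RationalFunction.slopeLeft_nonpos hp ⟨t.2.1, t.2.2.le⟩ ht
    split_ifs at h2 with hmid
    · exact ⟨hR, hL, by omega, fun h => absurd hmid h⟩
    · exact ⟨hR, hL, by omega, fun _ => by omega⟩
  have hR0 : ∀ e, ∀ t ∈ Set.Ico 0 (Γ.length e), f.toFun (Γ.edgePoint e t) = M →
      ¬ (e ∈ C ∧ t = Γ.length e / 2) → f.slopeRight e t = 0 := by
    intro e t ht htM hmid
    rcases ht.1.eq_or_lt with rfl | h0
    · rw [edgePoint_zero] at htM
      exact (RationalFunction.slopes_eq_zero_of_vertex hp htM (hvert _)).2.1 e rfl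
    · rw [Γ.edgePoint_of_mem e ⟨h0, ht.2⟩] at htM
      exact ((hint e ⟨t, h0, ht.2⟩ htM).2.2.2 hmid).1
  have hL0 : ∀ e, ∀ t ∈ Set.Ioc 0 (Γ.length e), f.toFun (Γ.edgePoint e t) = M →
      ¬ (e ∈ C ∧ t = Γ.length e / 2) → f.slopeLeft e t = 0 := by
    intro e t ht htM hmid
    rcases ht.2.eq_or_lt with rfl | h0
    · rw [edgePoint_length] at htM
      exact (RationalFunction.slopes_eq_zero_of_vertex hp htM (hvert _)).2.2 e rfl
    · rw [Γ.edgePoint_of_mem e ⟨ht.1, h0⟩] at htM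
      exact ((hint e ⟨t, ht.1, h0⟩ htM).2.2.2 hmid).2
  -- A maximum at one vertex spreads along the edges outside `C` to `v₀`, where the order would have
  -- to vanish although it is at least 1.
  have hnot : ∀ v, f.toFun (Sum.inl v) ≠ M := by
    intro v hv
    have hv₀ : f.toFun (Sum.inl v₀) = M := by
      refine hC (fun v => f.toFun (Sum.inl v) = M) (fun e he => ⟨fun h => ?_, fun h => ?_⟩) v v₀ hv
      · rw [← edgePoint_zero] at h
        exact RationalFunction.eq_at_tgt ⟨le_rfl, (Γ.length_pos e).le⟩ h
          fun s hs hsM => hR0 e s hs hsM fun h => he h.1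
      · rw [← edgePoint_length] at h
        exact RationalFunction.eq_at_src ⟨(Γ.length_pos e).le, le_rfl⟩ h
          fun s hs hsM => hL0 e s hs hsM fun h => he h.1
    have h1 := (RationalFunction.slopes_eq_zero_of_vertex hp hv₀ (hvert _)).1
    have h2 : 0 ≤ D (Sum.inl v₀) := hD _
    rw [← hf, Finsupp.sub_apply, midpointDivisor_inl, Finsupp.single_eq_same] at h1
    omega
  rcases p with v | ⟨e, t, ht⟩
  · exact hnot v rfl
  have htM : f.toFun (Γ.edgePoint e t) = M := by rw [Γ.edgePoint_of_mem e ht]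
  have hle : t ∈ Set.Icc 0 (Γ.length e) := ⟨ht.1.le, ht.2.le⟩
  -- From an interior maximum one walks to an end of the edge, away from the midpoint. At the
  -- midpoint itself two nonpositive slopes have sum at least `-1`, so one of them vanishes and
  -- gives the direction.
  by_cases hleft : t ≤ Γ.length e / 2 ∧ f.slopeLeft e t = 0
  · refine hnot _ (RationalFunction.eq_at_src hle htM fun s hs hsM => ?_)
    rcases hs.2.eq_or_lt with rfl | hst
    · exact hleft.2
    · exact hL0 e s ⟨hs.1, hs.2.trans ht.2.le⟩ hsM fun h => by linarith [hleft.1, h.2]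
  · refine hnot _ (RationalFunction.eq_at_tgt hle htM fun s hs hsM => ?_)
    have hmid : Γ.length e / 2 ≤ t ∧ f.slopeRight e t = 0 := by
      obtain ⟨h1, h2, h3, h4⟩ := hint e ⟨t, ht⟩ rfl
      dsimp only at h1 h2 h3 h4
      by_cases h5 : e ∈ C ∧ t = Γ.length e / 2
      · refine ⟨h5.2.ge, ?_⟩
        have : f.slopeLeft e t ≠ 0 := fun h => hleft ⟨h5.2.le, h⟩
        omega
      · have h6 := h4 h5
        refine ⟨?_, h6.1⟩
        by_contra! h7
        exact hleft ⟨h7.le, h6.2⟩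
    rcases hs.1.eq_or_lt with rfl | hst
    · exact hmid.2
    · exact hR0 e s ⟨ht.1.le.trans hs.1, hs.2⟩ hsM fun h => by linarith [hmid.1, h.2]

/-- In every degree at most the genus there is an effective divisor that is not equivalent
to an effective divisor containing a given vertex. -/
lemma exists_effective_not_linEquiv (Γ : MetricGraph V E) {k : ℤ} (hk : 0 ≤ k)
    (hkg : k ≤ Γ.genus) (v : V) : ∃ F : Γ.Divisor, 0 ≤ F ∧ deg F = k ∧
      ∀ D : Γ.Divisor, 0 ≤ D → ¬ LinEquiv (F - Finsupp.single (Sum.inl v) 1) D := by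
  lift k to ℕ using hk
  obtain ⟨C, hCk, hC⟩ := Γ.exists_removable_edges k hkg
  exact ⟨Γ.midpointDivisor C, midpointDivisor_nonneg C, by rw [deg_midpointDivisor, hCk],
    fun D hD => not_linEquiv_midpointDivisor_sub hC v hD⟩

/-! ### The two bounds on the Brill–Noether rank. -/

lemma brillNoetherRank_le (Γ : MetricGraph V E) {r d : ℤ} (hr : 0 ≤ r) (hrd : 2 * r ≤ d + 1)
    (hd : d ≤ Γ.genus) : Γ.brillNoetherRank r d ≤ d - 2 * r := by
  rcases (isGreatest_brillNoetherRank Γ (d := d) hr).1 with h | ⟨h0, h⟩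
  -- The value `-1` is within the bound exactly because `2 * r ≤ d + 1`.
  · omega
  by_contra! hlt
  set ρ := Γ.brillNoetherRank r d
  -- This brings the degree `r + ρ` of the test divisor down to at most the genus.
  have hρ : r + ρ ≤ d := by
    obtain ⟨F, hF, hFk⟩ := exists_effective_deg Γ (add_nonneg hr h0)
    obtain ⟨D, hFD, hDd, -⟩ := h F hF hFk
    have := deg_nonneg (sub_nonneg.2 hFD)
    rw [deg_sub] at this
    omega
  obtain ⟨v⟩ := Γ.connected.nonempty
  obtain ⟨F, hF, hFk, hFv⟩ := Γ.exists_effective_not_linEquiv (add_nonneg hr h0)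
    (hρ.trans hd) v
  obtain ⟨D, hFD, hDd, hDr⟩ := h F hF hFk
  have hDF : deg (D - F) = d - r - ρ := by rw [deg_sub]; omega
  have hrank := (isGreatest_rank D).1
  -- Membership in `rankSet D` is available at `rank D` itself, so `D - F` is padded with copies of
  -- `v` up to that degree. The multiplicity is at least 1, and all copies but one are added back
  -- afterwards.
  obtain ⟨D', hD', hl⟩ := hrank.2 (D - F + Finsupp.single (Sum.inl v) (rank D - (d - r - ρ)))
    (add_nonneg (sub_nonneg.2 hFD) (Finsupp.single_nonneg.2 (by omega)))
    (by rw [deg_add, deg_single, hDF]; ring)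
  refine hFv (D' + Finsupp.single (Sum.inl v) (rank D - (d - r - ρ) - 1))
    (add_nonneg hD' (Finsupp.single_nonneg.2 (by omega))) ?_
  have := hl.add (LinEquiv.refl (Finsupp.single (Sum.inl v) (rank D - (d - r - ρ) - 1)))
  rwa [Finsupp.single_sub _ (rank D - (d - r - ρ)) 1,
    show D - (D - F + Finsupp.single (Sum.inl v) (rank D - (d - r - ρ))) +
      (Finsupp.single (Sum.inl v) (rank D - (d - r - ρ)) - Finsupp.single (Sum.inl v) 1) =
      F - Finsupp.single (Sum.inl v) 1 by abel, ← Finsupp.single_sub] at this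

lemma IsHyperelliptic.le_brillNoetherRank (hΓ : Γ.IsHyperelliptic) {r d : ℤ} (hr : 0 ≤ r)
    (hrd : 2 * r ≤ d) : d - 2 * r ≤ Γ.brillNoetherRank r d := by
  refine (isGreatest_brillNoetherRank Γ hr).2 (Or.inr ⟨by omega, fun F hF hdeg => ?_⟩)
  lift r to ℕ using hr
  -- Here `deg F = r + (d - 2 * r) = d - r ≥ r`, so the divisor obtained has degree `d`.
  obtain ⟨D, hFD, hD, hrank⟩ := hΓ.exists_le_rank r hF (by omega)
  exact ⟨D, hFD, by omega, hrank⟩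

end MetricGraph

theorem mainTheorem5 {V E : Type*} [Fintype V] [Fintype E] (Γ : MetricGraph V E) (r d : ℤ)
    (hr : 0 < 2 * r) (hrd : 2 * r ≤ d) (hd : d < Γ.genus) :
    Γ.brillNoetherRank r d ≤ d - 2 * r ∧
      (Γ.IsHyperelliptic → Γ.brillNoetherRank r d = d - 2 * r) := by
  have hle := Γ.brillNoetherRank_le (r := r) (d := d) (by omega) (by omega) hd.le
  exact ⟨hle, fun hΓ => hle.antisymm (hΓ.le_brillNoetherRank (by omega) hrd)⟩
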